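/- Let $p$ be a prime and let $a, b \in \mathbb{F}_p^{\times}$ be distinct. Let $N$ be the number of triples $(x, y, z) \in \mathbb{F}_p^3$ such that $$x^2 + a = y^2 \quad\text{and}\quad x^2 + b = z^2.$$ Then $|N - (p-3)| \le 2\sqrt{p}$. -/

import Mathlib

/-!
Write `χ` for the quadratic character of `F = 𝔽_p`. Eliminating `y` and `z`, and then substituting
`u = x²`, shows that the number of solutions is `p - 3 + T`, where
`T = ∑ u, χ (u (u + a) (u + b))` (`card_intersection_eq`); the claim is thus the Hasse bound
`T² ≤ 4p` for the elliptic curve `E : y² = f(u) = u (u + a) (u + b)` (`sq_sum_quadraticChar_le`).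

The Hasse bound follows Manin's approach. Over `F(t)`, let `δ = f(t)` and consider the quadratic
twist of `E` by `δ`. Its points correspond to the endomorphisms of `E`, possibly followed by
translation by a `2`-torsion point; define the height of a point as the degree of its
`x`-coordinate on `E`, a rational function of `t`. The triple
`(x(P+Q)x(P-Q) : x(P+Q)+x(P-Q) : 1)` is expressed through `x(P)` and `x(Q)` by three forms of
bidegree `(2, 2)` with coefficients in `F`, which have no common zero over any extension
field of `F` (`exists_sym2x_add_sub`, `addSub_no_common_zero`). Hence neither a common polynomial
factor nor a drop of degree can appear when coprime polynomials are substituted in them, and the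
height satisfies the parallelogram law exactly (`twistedHeight_add_add_twistedHeight_sub`).

A nonnegative function with the parallelogram law satisfies the Cauchy–Schwarz inequality
(`parallelogram_sq_le`). It is applied to the points of the identity, of height `1`, and of the
Frobenius, of height `p`. The height of their difference is computed directly: cancelling common
factors of `f (f ^ ((p-1)/2) + 1)²` and `(t^p - t)²` with Euler's criterion gives `p + 1 + T`
(`exists_points_twistedHeight`).
-/

/-! ### Addition and subtraction on `x`-coordinates -/

section AddSubForms

variable {R S : Type*} [CommRing R] [CommRing S]

/-- The first coordinate of the map `(x(P), x(Q)) ↦ (x(P+Q)x(P-Q) : x(P+Q)+x(P-Q) : 1)` for the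
curve `y² = x³ + Ax² + Bx`, in homogeneous coordinates `(x₁ : z₁)` of `x(P)` and `(x₂ : z₂)`
of `x(Q)`. -/
def addSubProd (B x₁ z₁ x₂ z₂ : R) : R := (x₁ * x₂ - B * z₁ * z₂) ^ 2

/-- The second coordinate of the map described at `addSubProd`. -/
def addSubSum (A B x₁ z₁ x₂ z₂ : R) : R :=
  2 * ((x₁ * x₂ + B * z₁ * z₂) * (x₁ * z₂ + x₂ * z₁) + 2 * A * x₁ * x₂ * z₁ * z₂)

/-- The third coordinate of the map described at `addSubProd`. -/
def addSubDenom (x₁ z₁ x₂ z₂ : R) : R := (x₁ * z₂ - x₂ * z₁) ^ 2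

lemma map_addSubProd (f : R →+* S) (B x₁ z₁ x₂ z₂ : R) :
    f (addSubProd B x₁ z₁ x₂ z₂) = addSubProd (f B) (f x₁) (f z₁) (f x₂) (f z₂) := by
  simp [addSubProd]

lemma map_addSubSum (f : R →+* S) (A B x₁ z₁ x₂ z₂ : R) :
    f (addSubSum A B x₁ z₁ x₂ z₂) = addSubSum (f A) (f B) (f x₁) (f z₁) (f x₂) (f z₂) := by
  simp [addSubSum, map_ofNat]

lemma map_addSubDenom (f : R →+* S) (x₁ z₁ x₂ z₂ : R) :
    f (addSubDenom x₁ z₁ x₂ z₂) = addSubDenom (f x₁) (f z₁) (f x₂) (f z₂) := by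
  simp [addSubDenom]

/-- The three forms have no common zero on `ℙ¹ × ℙ¹` when `x³ + Ax² + Bx` is separable: they
define a morphism `ℙ¹ × ℙ¹ → ℙ²`. -/
lemma addSub_no_common_zero {K : Type*} [Field K] {A B x₁ z₁ x₂ z₂ : K} (h2 : (2 : K) ≠ 0)
    (hB : B ≠ 0) (hAB : A ^ 2 - 4 * B ≠ 0) (h₁ : x₁ ≠ 0 ∨ z₁ ≠ 0) (h₂ : x₂ ≠ 0 ∨ z₂ ≠ 0) :
    addSubProd B x₁ z₁ x₂ z₂ ≠ 0 ∨ addSubSum A B x₁ z₁ x₂ z₂ ≠ 0 ∨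
      addSubDenom x₁ z₁ x₂ z₂ ≠ 0 := by
  by_contra! ⟨hp, hs, hd⟩
  rw [addSubProd, sq_eq_zero_iff] at hp
  rw [addSubDenom, sq_eq_zero_iff] at hd
  rw [addSubSum, mul_eq_zero_iff_left h2] at hs
  by_cases hz₁ : z₁ = 0
  · subst hz₁
    have hx₁ : x₁ ≠ 0 := by simpa using h₁
    have : x₂ = 0 := by simpa [hx₁] using hp
    have : z₂ = 0 := by simpa [hx₁] using hd
    simp_all
  by_cases hz₂ : z₂ = 0
  · subst hz₂
    have hx₂ : x₂ ≠ 0 := by simpa using h₂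
    have : x₁ = 0 := by simpa [hx₂] using hp
    have : z₁ = 0 := by simpa [hx₂] using hd
    simp_all
  -- The two points of `ℙ¹` now agree, and are affine with coordinate `x`.
  obtain ⟨x, rfl⟩ : ∃ x, x₁ = x * z₁ := ⟨x₁ / z₁, by field_simp⟩
  obtain rfl : x₂ = x * z₂ := by
    apply mul_right_cancel₀ hz₁
    linear_combination -hd
  have hx : x ^ 2 = B := by
    apply mul_right_cancel₀ (mul_ne_zero hz₁ hz₂)
    linear_combination hp
  have h : 2 * B * (2 * x + A) = 0 := by
    apply mul_right_cancel₀ (pow_ne_zero 2 (mul_ne_zero hz₁ hz₂))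
    linear_combination hs - 2 * (x + A) * (z₁ * z₂) ^ 2 * hx
  have h' : 2 * x + A = 0 := by simpa [h2, hB] using h
  apply hAB
  linear_combination (A - 2 * x) * h' + 4 * hx

end AddSubForms

section Curve

open WeierstrassCurve.Affine

variable {K : Type*} [Field K]

/-- The curve `y² = x³ + Ax² + Bx`. -/
def twoTorsionCurve (A B : K) : WeierstrassCurve.Affine K := ⟨0, A, 0, B, 0⟩

lemma twoTorsionCurve_equation_iff {A B x y : K} :
    (twoTorsionCurve A B).Equation x y ↔ y ^ 2 = x ^ 3 + A * x ^ 2 + B * x := by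
  rw [equation_iff]; simp [twoTorsionCurve]

lemma twoTorsionCurve_nonsingular {A B x y : K} (h2 : (2 : K) ≠ 0)
    (h : y ^ 2 = x ^ 3 + A * x ^ 2 + B * x) (hy : y ≠ 0) :
    (twoTorsionCurve A B).Nonsingular x y := by
  rw [nonsingular_iff]
  refine ⟨twoTorsionCurve_equation_iff.2 h, Or.inr fun h' => hy ?_⟩
  simp only [twoTorsionCurve] at h'
  have : 2 * y = 0 := by linear_combination h'
  simpa [h2] using this

variable [DecidableEq K]

/-- The three forms describe addition and subtraction on the curve `y² = x³ + Ax² + Bx`: the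
triple `(x(P+Q)x(P-Q) : x(P+Q)+x(P-Q) : 1)` is proportional to their values. -/
lemma exists_sym2x_add_sub {A B : K} (h2 : (2 : K) ≠ 0) (P Q : (twoTorsionCurve A B).Point) :
    ∃ c : K, c ≠ 0 ∧
      (P + Q).xRep 0 * (P - Q).xRep 0 =
        c * addSubProd B (P.xRep 0) (P.xRep 1) (Q.xRep 0) (Q.xRep 1) ∧
      (P + Q).xRep 0 * (P - Q).xRep 1 + (P + Q).xRep 1 * (P - Q).xRep 0 =
        c * addSubSum A B (P.xRep 0) (P.xRep 1) (Q.xRep 0) (Q.xRep 1) ∧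
      (P + Q).xRep 1 * (P - Q).xRep 1 =
        c * addSubDenom (P.xRep 0) (P.xRep 1) (Q.xRep 0) (Q.xRep 1) := by
  match P, Q with
  | 0, Q =>
    refine ⟨1, one_ne_zero, ?_⟩
    rw [zero_add, zero_sub, Point.xRep_neg]
    simp only [addSubProd, addSubSum, addSubDenom, Point.xRep_zero, Matrix.cons_val_zero,
      Matrix.cons_val_one]
    refine ⟨by ring, by ring, by ring⟩
  | P, 0 =>
    refine ⟨1, one_ne_zero, ?_⟩
    rw [add_zero, sub_zero]
    simp only [addSubProd, addSubSum, addSubDenom, Point.xRep_zero, Matrix.cons_val_zero,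
      Matrix.cons_val_one]
    refine ⟨by ring, by ring, by ring⟩
  | .some x₁ y₁ h₁, .some x₂ y₂ h₂ =>
    have e₁ := twoTorsionCurve_equation_iff.1 h₁.left
    have e₂ := twoTorsionCurve_equation_iff.1 h₂.left
    by_cases hx : x₁ = x₂
    · -- It suffices to treat `P = Q`, as the roles of `P + Q` and `P - Q` are symmetric.
      have dbl : ∃ c : K, c ≠ 0 ∧
          (Point.some x₁ y₁ h₁ + Point.some x₁ y₁ h₁).xRep 0 = c * addSubProd B x₁ 1 x₁ 1 ∧
          (Point.some x₁ y₁ h₁ + Point.some x₁ y₁ h₁).xRep 1 = c * addSubSum A B x₁ 1 x₁ 1 := by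
        by_cases hy : y₁ = 0
        · have hB : x₁ ^ 2 - B ≠ 0 := by
            intro hB
            have hns := ((nonsingular_iff _ _).1 h₁).2
            simp only [twoTorsionCurve] at hns
            subst hy
            simp only [zero_mul, mul_zero, sub_zero, neg_zero, ne_eq, not_true_eq_false,
              or_false] at hns
            by_cases hx0 : x₁ = 0
            · subst hx0
              apply hns
              linear_combination hB
            · have h0 : 2 * B + A * x₁ = 0 := by
                apply mul_left_cancel₀ hx0
                linear_combination -e₁ - x₁ * hB
              apply hns
              linear_combination -3 * hB - 2 * h0
          refine ⟨((x₁ ^ 2 - B) ^ 2)⁻¹, inv_ne_zero (pow_ne_zero 2 hB), ?_⟩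
          rw [Point.add_self_of_Y_eq (by simp [hy, negY, twoTorsionCurve])]
          simp only [Point.xRep_zero, Matrix.cons_val_zero, Matrix.cons_val_one, addSubProd,
            addSubSum]
          constructor
          · rw [eq_comm, inv_mul_eq_one₀ (pow_ne_zero 2 hB)]; ring
          · rw [eq_comm, mul_eq_zero]
            right
            subst hy
            linear_combination -4 * e₁
        · have hy' : y₁ ≠ (twoTorsionCurve A B).negY x₁ y₁ := by
            simp only [negY, twoTorsionCurve]
            intro h
            have : 2 * y₁ = 0 := by linear_combination h
            exact hy ((mul_eq_zero_iff_left h2).1 this)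
          have h4 : (4 : K) ≠ 0 := by
            have : (4 : K) = 2 * 2 := by norm_num
            rw [this]; exact mul_ne_zero h2 h2
          refine ⟨(4 * y₁ ^ 2)⁻¹, inv_ne_zero (mul_ne_zero h4 (pow_ne_zero 2 hy)), ?_⟩
          rw [Point.add_self_of_Y_ne hy', Point.xRep_some]
          simp only [Matrix.cons_val_zero, Matrix.cons_val_one, addSubProd, addSubSum,
            slope_of_Y_ne rfl hy', addX]
          simp only [negY, twoTorsionCurve]
          have hyy : y₁ - (-y₁ - 0 * x₁ - 0) = 2 * y₁ := by ring
          rw [hyy]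
          constructor
          · field_simp
            linear_combination (-16 * (A + 2 * x₁)) * e₁
          · field_simp
            linear_combination 4 * e₁
      obtain ⟨c, hc, hc0, hc1⟩ := dbl
      have hd : addSubDenom x₁ 1 x₁ 1 = 0 := by simp [addSubDenom]
      refine ⟨c, hc, ?_⟩
      rcases Point.X_eq_iff (h₁ := h₁) (h₂ := h₂).1 hx with h | h
      · rw [← h, sub_self]
        simp only [Point.xRep_some, Matrix.cons_val_zero, Matrix.cons_val_one, hc0, hc1, hd]
        simp
      · have h' : Point.some x₂ y₂ h₂ = -Point.some x₁ y₁ h₁ := by rw [h, neg_neg]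
        rw [h', add_neg_cancel, sub_neg_eq_add, Point.xRep_neg]
        simp only [Point.xRep_some, Matrix.cons_val_zero, Matrix.cons_val_one, hc0, hc1, hd]
        simp
    · refine ⟨((x₁ - x₂) ^ 2)⁻¹, inv_ne_zero (pow_ne_zero 2 (sub_ne_zero.2 hx)), ?_⟩
      rw [sub_eq_add_neg, Point.neg_some, Point.add_of_X_ne hx, Point.add_of_X_ne hx]
      simp only [Point.xRep_some, Matrix.cons_val_zero, Matrix.cons_val_one, addSubProd,
        addSubSum, addSubDenom, slope_of_X_ne hx, addX]
      simp only [negY, twoTorsionCurve]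
      have hx' : x₁ - x₂ ≠ 0 := sub_ne_zero.2 hx
      refine ⟨?_, ?_, ?_⟩
      · field_simp
        linear_combination
          (y₁ ^ 2 + (x₁ ^ 3 + A * x₁ ^ 2 + B * x₁) - 2 * y₂ ^ 2
            - 2 * (A + x₁ + x₂) * (x₁ - x₂) ^ 2) * e₁ +
          (y₂ ^ 2 + (x₂ ^ 3 + A * x₂ ^ 2 + B * x₂) - 2 * (x₁ ^ 3 + A * x₁ ^ 2 + B * x₁)
            - 2 * (A + x₁ + x₂) * (x₁ - x₂) ^ 2) * e₂
      · field_simp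
        linear_combination 2 * e₁ + 2 * e₂
      · field_simp

end Curve

/-! ### Primitive triples of polynomials -/

section Primitive

open Polynomial

variable {F : Type*} [Field F]

/-- Three polynomials are a primitive triple if no irreducible polynomial divides all of them. -/
def IsPrimitiveTriple (a b c : F[X]) : Prop :=
  ∀ π : F[X], Irreducible π → π ∣ a → π ∣ b → ¬ π ∣ c

/-- The largest degree in a triple of polynomials. -/
def tripleDegree (a b c : F[X]) : ℕ := max a.natDegree (max b.natDegree c.natDegree)

lemma tripleDegree_eq_of_coeff {a b c : F[X]} {n : ℕ} (ha : a.natDegree ≤ n)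
    (hb : b.natDegree ≤ n) (hc : c.natDegree ≤ n)
    (h : a.coeff n ≠ 0 ∨ b.coeff n ≠ 0 ∨ c.coeff n ≠ 0) : tripleDegree a b c = n := by
  refine le_antisymm (max_le ha (max_le hb hc)) ?_
  rw [tripleDegree, le_max_iff, le_max_iff]
  rcases h with h | h | h
  · exact Or.inl (le_natDegree_of_ne_zero h)
  · exact Or.inr (Or.inl (le_natDegree_of_ne_zero h))
  · exact Or.inr (Or.inr (le_natDegree_of_ne_zero h))

/-- If the primitive triple times `m / n`, in lowest terms, is integral, then `n` is a unit. -/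
lemma isUnit_of_mul_eq_mul_of_isPrimitiveTriple {a b c a' b' c' m n : F[X]}
    (h' : IsPrimitiveTriple a' b' c') (hmn : IsCoprime m n) (hn : n ≠ 0) (ha : n * a = m * a')
    (hb : n * b = m * b') (hc : n * c = m * c') : IsUnit n := by
  by_contra hu
  obtain ⟨π, hπ, hdvd⟩ := WfDvdMonoid.exists_irreducible_factor hu hn
  have key : ∀ {x y : F[X]}, n * x = m * y → π ∣ y := fun {x y} hxy => by
    have h1 : n ∣ m * y := ⟨x, hxy.symm⟩
    exact hdvd.trans (hmn.symm.dvd_of_dvd_mul_left h1)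
  exact h' π hπ (key ha) (key hb) (key hc)

/-- Proportional primitive triples have the same degree. -/
lemma tripleDegree_eq_of_proportional {a b c a' b' c' : F[X]} {k : RatFunc F} (hk : k ≠ 0)
    (h : IsPrimitiveTriple a b c) (h' : IsPrimitiveTriple a' b' c')
    (ha : algebraMap F[X] (RatFunc F) a = k * algebraMap _ _ a')
    (hb : algebraMap F[X] (RatFunc F) b = k * algebraMap _ _ b')
    (hc : algebraMap F[X] (RatFunc F) c = k * algebraMap _ _ c') :
    tripleDegree a b c = tripleDegree a' b' c' := by
  have hn : k.denom ≠ 0 := k.denom_ne_zero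
  have hm : k.num ≠ 0 := RatFunc.num_ne_zero hk
  have clear : ∀ {x y : F[X]}, algebraMap F[X] (RatFunc F) x = k * algebraMap _ _ y →
      k.denom * x = k.num * y := fun {x y} hxy => by
    apply RatFunc.algebraMap_injective F
    have hn' : algebraMap F[X] (RatFunc F) k.denom ≠ 0 := RatFunc.algebraMap_ne_zero hn
    have hk' := RatFunc.num_div_denom k
    rw [map_mul, map_mul, hxy]
    nth_rewrite 2 [← hk']
    field_simp
  have hun : IsUnit k.denom := isUnit_of_mul_eq_mul_of_isPrimitiveTriple h'
    k.isCoprime_num_denom hn (clear ha) (clear hb) (clear hc)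
  have hum : IsUnit k.num := isUnit_of_mul_eq_mul_of_isPrimitiveTriple h
    k.isCoprime_num_denom.symm hm (clear ha).symm (clear hb).symm (clear hc).symm
  have deg : ∀ {x y : F[X]}, algebraMap F[X] (RatFunc F) x = k * algebraMap _ _ y →
      x.natDegree = y.natDegree := fun {x y} hxy => by
    obtain ⟨r, hr, hr'⟩ := Polynomial.isUnit_iff.1 hun
    obtain ⟨s, hs, hs'⟩ := Polynomial.isUnit_iff.1 hum
    have := clear hxy
    rw [← hr', ← hs'] at this
    rw [← natDegree_C_mul hr.ne_zero, this, natDegree_C_mul hs.ne_zero]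
  rw [tripleDegree, tripleDegree, deg ha, deg hb, deg hc]

/-- The height of a point `(x : z)` of `ℙ¹` given by coprime polynomials. -/
def pairDegree (x z : F[X]) : ℕ := max x.natDegree z.natDegree

lemma natDegree_le_pairDegree_left (x z : F[X]) : x.natDegree ≤ pairDegree x z := le_max_left _ _

lemma natDegree_le_pairDegree_right (x z : F[X]) : z.natDegree ≤ pairDegree x z := le_max_right _ _

lemma coeff_pairDegree_ne_zero {x z : F[X]} (h : IsCoprime x z) :
    x.coeff (pairDegree x z) ≠ 0 ∨ z.coeff (pairDegree x z) ≠ 0 := by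
  by_contra! ⟨hx, hz⟩
  have hzero : ∀ {f : F[X]}, f.coeff f.natDegree = 0 → f = 0 := fun hf => by simpa using hf
  rcases le_total z.natDegree x.natDegree with hle | hle
  · rw [pairDegree, max_eq_left hle] at hx hz
    have hx0 := hzero hx
    rw [hx0, natDegree_zero] at hle hz
    have hz0 : z = 0 := hzero (by rwa [Nat.le_zero.1 hle])
    rw [hx0, hz0] at h
    exact not_isCoprime_zero_zero h
  · rw [pairDegree, max_eq_right hle] at hx hz
    have hz0 := hzero hz
    rw [hz0, natDegree_zero] at hle hx
    have hx0 : x = 0 := hzero (by rwa [Nat.le_zero.1 hle])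
    rw [hx0, hz0] at h
    exact not_isCoprime_zero_zero h

lemma mk_ne_zero_of_isCoprime {x z π : F[X]} (hπ : Irreducible π) (h : IsCoprime x z) :
    AdjoinRoot.mk π x ≠ 0 ∨ AdjoinRoot.mk π z ≠ 0 := by
  by_contra! ⟨hx, hz⟩
  exact hπ.not_isUnit (h.isUnit_of_dvd' (AdjoinRoot.mk_eq_zero.1 hx) (AdjoinRoot.mk_eq_zero.1 hz))

/-- The map `ℙ¹ × ℙ¹ → ℙ²` multiplying two binary linear forms has no base points. -/
lemma mul_no_common_zero {K : Type*} [Field K] {u v r s : K} (h₁ : u ≠ 0 ∨ v ≠ 0)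
    (h₂ : r ≠ 0 ∨ s ≠ 0) : u * r ≠ 0 ∨ u * s + v * r ≠ 0 ∨ v * s ≠ 0 := by
  grind

lemma isPrimitiveTriple_mul {u v r s : F[X]} (h₁ : IsCoprime u v) (h₂ : IsCoprime r s) :
    IsPrimitiveTriple (u * r) (u * s + v * r) (v * s) := by
  intro π hπ h0 h1 h2
  have : Fact (Irreducible π) := ⟨hπ⟩
  rw [← AdjoinRoot.mk_eq_zero] at h0 h1 h2
  simp only [map_mul, map_add] at h0 h1 h2
  have := mul_no_common_zero (mk_ne_zero_of_isCoprime hπ h₁) (mk_ne_zero_of_isCoprime hπ h₂)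
  tauto

lemma tripleDegree_mul {u v r s : F[X]} (h₁ : IsCoprime u v) (h₂ : IsCoprime r s) :
    tripleDegree (u * r) (u * s + v * r) (v * s) = pairDegree u v + pairDegree r s := by
  have du := natDegree_le_pairDegree_left u v
  have dv := natDegree_le_pairDegree_right u v
  have dr := natDegree_le_pairDegree_left r s
  have ds := natDegree_le_pairDegree_right r s
  refine tripleDegree_eq_of_coeff (natDegree_mul_le_of_le du dr)
    (natDegree_add_le_of_degree_le (natDegree_mul_le_of_le du ds) (natDegree_mul_le_of_le dv dr))
    (natDegree_mul_le_of_le dv ds) ?_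
  rw [coeff_add, coeff_mul_add_eq_of_natDegree_le du dr, coeff_mul_add_eq_of_natDegree_le du ds,
    coeff_mul_add_eq_of_natDegree_le dv dr, coeff_mul_add_eq_of_natDegree_le dv ds]
  exact mul_no_common_zero (coeff_pairDegree_ne_zero h₁) (coeff_pairDegree_ne_zero h₂)

variable {A B : F} {x₁ z₁ x₂ z₂ : F[X]}

/-- No irreducible `π` divides all three values, since the forms have no common zero over the
residue field of `π`. -/
lemma isPrimitiveTriple_addSub (h2 : (2 : F) ≠ 0) (hB : B ≠ 0) (hAB : A ^ 2 - 4 * B ≠ 0)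
    (h₁ : IsCoprime x₁ z₁) (h₂ : IsCoprime x₂ z₂) :
    IsPrimitiveTriple (addSubProd (C B) x₁ z₁ x₂ z₂) (addSubSum (C A) (C B) x₁ z₁ x₂ z₂)
      (addSubDenom x₁ z₁ x₂ z₂) := by
  intro π hπ d0 d1 d2
  have : Fact (Irreducible π) := ⟨hπ⟩
  rw [← AdjoinRoot.mk_eq_zero] at d0 d1 d2
  rw [map_addSubProd] at d0
  rw [map_addSubSum] at d1
  rw [map_addSubDenom] at d2
  have hinj := ((AdjoinRoot.mk π).comp C).injective
  have h2' : (2 : AdjoinRoot π) ≠ 0 := by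
    have := (map_ne_zero_iff _ hinj).2 h2
    rwa [map_ofNat] at this
  have hB' : AdjoinRoot.mk π (C B) ≠ 0 := (map_ne_zero_iff _ hinj).2 hB
  have hAB' : AdjoinRoot.mk π (C A) ^ 2 - 4 * AdjoinRoot.mk π (C B) ≠ 0 := by
    have := (map_ne_zero_iff _ hinj).2 hAB
    rwa [map_sub, map_mul, map_pow, map_ofNat] at this
  have := addSub_no_common_zero h2' hB' hAB' (mk_ne_zero_of_isCoprime hπ h₁)
    (mk_ne_zero_of_isCoprime hπ h₂)
  tauto

/-- The addition and subtraction forms have bidegree `(2, 2)`, and no cancellation of leading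
coefficients can occur as these forms have no common zero over `F`. -/
lemma tripleDegree_addSub (h2 : (2 : F) ≠ 0) (hB : B ≠ 0) (hAB : A ^ 2 - 4 * B ≠ 0)
    (h₁ : IsCoprime x₁ z₁) (h₂ : IsCoprime x₂ z₂) :
    tripleDegree (addSubProd (C B) x₁ z₁ x₂ z₂) (addSubSum (C A) (C B) x₁ z₁ x₂ z₂)
      (addSubDenom x₁ z₁ x₂ z₂) = 2 * pairDegree x₁ z₁ + 2 * pairDegree x₂ z₂ := by
  have dx₁ := natDegree_le_pairDegree_left x₁ z₁
  have dz₁ := natDegree_le_pairDegree_right x₁ z₁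
  have dx₂ := natDegree_le_pairDegree_left x₂ z₂
  have dz₂ := natDegree_le_pairDegree_right x₂ z₂
  have nz := addSub_no_common_zero h2 hB hAB (coeff_pairDegree_ne_zero h₁)
    (coeff_pairDegree_ne_zero h₂)
  set m := pairDegree x₁ z₁
  set n := pairDegree x₂ z₂
  -- A product of two polynomials of degree at most `m + n`, and its top coefficient.
  have quad : ∀ {f g : F[X]}, f.natDegree ≤ m + n → g.natDegree ≤ m + n →
      (f * g).natDegree ≤ 2 * m + 2 * n ∧
        (f * g).coeff (2 * m + 2 * n) = f.coeff (m + n) * g.coeff (m + n) := fun {f g} hf hg => by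
    have e : 2 * m + 2 * n = (m + n) + (m + n) := by ring
    rw [e]
    exact ⟨natDegree_mul_le_of_le hf hg, coeff_mul_add_eq_of_natDegree_le hf hg⟩
  have xx : (x₁ * x₂).natDegree ≤ m + n := natDegree_mul_le_of_le dx₁ dx₂
  have zz : (z₁ * z₂).natDegree ≤ m + n := natDegree_mul_le_of_le dz₁ dz₂
  have xz : (x₁ * z₂).natDegree ≤ m + n := natDegree_mul_le_of_le dx₁ dz₂
  have zx : (z₁ * x₂).natDegree ≤ m + n := natDegree_mul_le_of_le dz₁ dx₂
  have Bzz : (C B * (z₁ * z₂)).natDegree ≤ m + n := (natDegree_C_mul_le _ _).trans zz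
  have cxx := coeff_mul_add_eq_of_natDegree_le dx₁ dx₂
  have czz := coeff_mul_add_eq_of_natDegree_le dz₁ dz₂
  have cxz := coeff_mul_add_eq_of_natDegree_le dx₁ dz₂
  have czx := coeff_mul_add_eq_of_natDegree_le dz₁ dx₂
  have e0 : addSubProd (C B) x₁ z₁ x₂ z₂ =
      (x₁ * x₂ - C B * (z₁ * z₂)) * (x₁ * x₂ - C B * (z₁ * z₂)) := by rw [addSubProd]; ring
  have e1 : addSubSum (C A) (C B) x₁ z₁ x₂ z₂ =
      C 2 * ((x₁ * x₂ + C B * (z₁ * z₂)) * (x₁ * z₂ + z₁ * x₂)) +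
        C (4 * A) * ((x₁ * x₂) * (z₁ * z₂)) := by
    rw [addSubSum]
    simp only [C_mul, map_ofNat]
    ring
  have e2 : addSubDenom x₁ z₁ x₂ z₂ =
      (x₁ * z₂ - z₁ * x₂) * (x₁ * z₂ - z₁ * x₂) := by rw [addSubDenom]; ring
  have l0 : (x₁ * x₂ - C B * (z₁ * z₂)).natDegree ≤ m + n :=
    (natDegree_sub_le _ _).trans (max_le xx Bzz)
  have l1 : (x₁ * z₂ + z₁ * x₂).natDegree ≤ m + n := natDegree_add_le_of_degree_le xz zx
  have l2 : (x₁ * z₂ - z₁ * x₂).natDegree ≤ m + n := (natDegree_sub_le _ _).trans (max_le xz zx)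
  have q0 := quad l0 l0
  have q1 := quad (natDegree_add_le_of_degree_le xx Bzz) l1
  have q1' := quad xx zz
  have q2 := quad l2 l2
  rw [e0, e1, e2]
  refine tripleDegree_eq_of_coeff q0.1 (natDegree_add_le_of_degree_le
    ((natDegree_C_mul_le _ _).trans q1.1) ((natDegree_C_mul_le _ _).trans q1'.1)) q2.1 ?_
  have c0 : (addSubProd B (x₁.coeff m) (z₁.coeff m) (x₂.coeff n) (z₂.coeff n)) =
      ((x₁ * x₂ - C B * (z₁ * z₂)) * (x₁ * x₂ - C B * (z₁ * z₂))).coeff (2 * m + 2 * n) := by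
    rw [q0.2, coeff_sub, coeff_C_mul, cxx, czz, addSubProd]
    ring
  have c1 : (addSubSum A B (x₁.coeff m) (z₁.coeff m) (x₂.coeff n) (z₂.coeff n)) =
      (C 2 * ((x₁ * x₂ + C B * (z₁ * z₂)) * (x₁ * z₂ + z₁ * x₂)) +
        C (4 * A) * ((x₁ * x₂) * (z₁ * z₂))).coeff (2 * m + 2 * n) := by
    rw [coeff_add, coeff_C_mul, coeff_C_mul, q1.2, q1'.2, coeff_add, coeff_add, coeff_C_mul, cxx,
      czz, cxz, czx, addSubSum]
    ring
  have c2 : (addSubDenom (x₁.coeff m) (z₁.coeff m) (x₂.coeff n) (z₂.coeff n)) =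
      ((x₁ * z₂ - z₁ * x₂) * (x₁ * z₂ - z₁ * x₂)).coeff (2 * m + 2 * n) := by
    rw [q2.2, coeff_sub, cxz, czx, addSubDenom]
    ring
  rwa [c0, c1, c2] at nz

end Primitive

/-! ### The height of a point over the rational function field -/

section Height

open Polynomial WeierstrassCurve.Affine

variable {F : Type*} [Field F] {A B : F} {δ : RatFunc F}

/-- The curve `y² = x³ + δAx² + δ²Bx` over `F(t)`: the quadratic twist by `δ` of the constant curve
`y² = x³ + Ax² + Bx`. -/
noncomputable abbrev twistedCurve (A B : F) (δ : RatFunc F) : WeierstrassCurve.Affine (RatFunc F) :=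
  twoTorsionCurve (δ * algebraMap F[X] (RatFunc F) (C A))
    (δ ^ 2 * algebraMap F[X] (RatFunc F) (C B))

/-- Coprime polynomials `x`, `z` are reduced coordinates of a point `P` of the twisted curve if
`(x : z)` is the `x`-coordinate of `P` on the constant curve, that is, `x(P) / δ`. -/
structure IsReducedCoord (P : (twistedCurve A B δ).Point) (x z : F[X]) : Prop where
  isCoprime : IsCoprime x z
  exists_scalar : ∃ d : RatFunc F, d ≠ 0 ∧ P.xRep 0 = d * (δ * algebraMap _ _ x) ∧
    P.xRep 1 = d * algebraMap _ _ z

/-- The height of a point of the twisted curve: the degree of `x(P) / δ` as a rational function.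
At the point at infinity the division by `0` in this formula gives the correct value `0`. -/
noncomputable def twistedHeight (P : (twistedCurve A B δ).Point) : ℕ :=
  pairDegree (P.xRep 0 / (δ * P.xRep 1)).num (P.xRep 0 / (δ * P.xRep 1)).denom

lemma isReducedCoord_some {x y : RatFunc F} (hδ : δ ≠ 0) {n d : F[X]} (hd : d ≠ 0)
    (hnd : IsCoprime n d) (h : (twistedCurve A B δ).Nonsingular x y)
    (hx : x = δ * (algebraMap _ _ n / algebraMap _ _ d)) :
    IsReducedCoord (Point.some x y h) n d := by
  have hd' : algebraMap F[X] (RatFunc F) d ≠ 0 := RatFunc.algebraMap_ne_zero hd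
  refine ⟨hnd, (algebraMap _ _ d)⁻¹, inv_ne_zero hd', ?_, ?_⟩
  · simp only [Point.xRep_some, Matrix.cons_val_zero, hx]
    field_simp
  · simp only [Point.xRep_some, Matrix.cons_val_one, Matrix.cons_val_zero]
    field_simp

lemma IsReducedCoord.pairDegree_eq (hδ : δ ≠ 0) {P : (twistedCurve A B δ).Point} {x z x' z' : F[X]}
    (h : IsReducedCoord P x z) (h' : IsReducedCoord P x' z') :
    pairDegree x z = pairDegree x' z' := by
  obtain ⟨hc, d, hd, h0, h1⟩ := h
  obtain ⟨hc', d', hd', h0', h1'⟩ := h'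
  have prim : ∀ {x z : F[X]}, IsCoprime x z → IsPrimitiveTriple x z z := fun hxz π hπ hx hz _ =>
    hπ.not_isUnit (hxz.isUnit_of_dvd' hx hz)
  have hz : algebraMap F[X] (RatFunc F) z = d' / d * algebraMap _ _ z' := by
    have := h1.symm.trans h1'
    field_simp
    linear_combination this
  have hx : algebraMap F[X] (RatFunc F) x = d' / d * algebraMap _ _ x' := by
    have : d * algebraMap F[X] (RatFunc F) x = d' * algebraMap F[X] (RatFunc F) x' := by
      apply mul_left_cancel₀ hδ
      linear_combination h0.symm.trans h0'
    field_simp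
    linear_combination this
  have := tripleDegree_eq_of_proportional (div_ne_zero hd' hd) (prim hc) (prim hc')
    hx hz hz
  simpa [tripleDegree, pairDegree] using this

lemma exists_isReducedCoord (hδ : δ ≠ 0) (P : (twistedCurve A B δ).Point) :
    ∃ x z, IsReducedCoord P x z ∧ twistedHeight P = pairDegree x z := by
  match P with
  | 0 =>
    refine ⟨1, 0, ⟨isCoprime_one_left, δ⁻¹, inv_ne_zero hδ, ?_, ?_⟩, ?_⟩
    · simp [hδ]
    · simp
    · simp [twistedHeight, pairDegree]
  | .some x y h =>
    refine ⟨_, _, isReducedCoord_some hδ (RatFunc.denom_ne_zero _)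
      (RatFunc.isCoprime_num_denom (x / (δ * 1))) h ?_, ?_⟩
    · rw [RatFunc.num_div_denom]
      field_simp
    · simp [twistedHeight]

lemma IsReducedCoord.twistedHeight_eq (hδ : δ ≠ 0) {P : (twistedCurve A B δ).Point} {x z : F[X]}
    (h : IsReducedCoord P x z) : twistedHeight P = pairDegree x z := by
  obtain ⟨x', z', h', e⟩ := exists_isReducedCoord hδ P
  rw [e, h'.pairDegree_eq hδ h]

/-- The height on the twisted curve satisfies the parallelogram law exactly, since the addition
and subtraction forms have constant coefficients, hence good reduction at every place of `F(t)`. -/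
lemma twistedHeight_add_add_twistedHeight_sub [DecidableEq (RatFunc F)] (h2 : (2 : F) ≠ 0)
    (hB : B ≠ 0) (hAB : A ^ 2 - 4 * B ≠ 0) (hδ : δ ≠ 0) (P Q : (twistedCurve A B δ).Point) :
    twistedHeight (P + Q) + twistedHeight (P - Q) =
      2 * twistedHeight P + 2 * twistedHeight Q := by
  obtain ⟨x₁, z₁, h₁, e₁⟩ := exists_isReducedCoord hδ P
  obtain ⟨x₂, z₂, h₂, e₂⟩ := exists_isReducedCoord hδ Q
  obtain ⟨u, v, h₃, e₃⟩ := exists_isReducedCoord hδ (P + Q)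
  obtain ⟨r, s, h₄, e₄⟩ := exists_isReducedCoord hδ (P - Q)
  have h2' : (2 : RatFunc F) ≠ 0 := by
    have := (map_ne_zero_iff _ (algebraMap F (RatFunc F)).injective).2 h2
    rwa [map_ofNat] at this
  obtain ⟨c, hc, k0, k1, k2⟩ := exists_sym2x_add_sub h2' P Q
  rw [e₁, e₂, e₃, e₄, ← tripleDegree_mul h₃.1 h₄.1, ← tripleDegree_addSub h2 hB hAB h₁.1 h₂.1]
  obtain ⟨i₁, d₁, n₁, a₁, b₁⟩ := h₁
  obtain ⟨i₂, d₂, n₂, a₂, b₂⟩ := h₂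
  obtain ⟨i₃, d₃, n₃, a₃, b₃⟩ := h₃
  obtain ⟨i₄, d₄, n₄, a₄, b₄⟩ := h₄
  rw [a₁, b₁, a₂, b₂, a₃, a₄] at k0
  rw [a₁, b₁, a₂, b₂, a₃, a₄, b₃, b₄] at k1
  rw [a₁, b₁, a₂, b₂, b₃, b₄] at k2
  have n₃₄ := mul_ne_zero n₃ n₄
  refine tripleDegree_eq_of_proportional (k := c * d₁ ^ 2 * d₂ ^ 2 * δ ^ 2 / (d₃ * d₄))
    (by positivity) (isPrimitiveTriple_mul i₃ i₄)
    (isPrimitiveTriple_addSub h2 hB hAB i₁ i₂) ?_ ?_ ?_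
  · rw [map_addSubProd, map_mul, div_mul_eq_mul_div, eq_div_iff n₃₄]
    apply mul_left_cancel₀ (pow_ne_zero 2 hδ)
    simp only [addSubProd] at k0 ⊢
    linear_combination k0
  · rw [map_addSubSum, map_add, map_mul, map_mul, div_mul_eq_mul_div, eq_div_iff n₃₄]
    apply mul_left_cancel₀ hδ
    simp only [addSubSum] at k1 ⊢
    linear_combination k1
  · rw [map_addSubDenom, map_mul, div_mul_eq_mul_div, eq_div_iff n₃₄]
    simp only [addSubDenom] at k2 ⊢
    linear_combination k2

end Height

/-! ### The Cauchy–Schwarz inequality for functions satisfying the parallelogram law -/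

section Parallelogram

variable {G : Type*} [AddCommGroup G] {h : G → ℤ}

/-- A function satisfying the parallelogram law is a quadratic polynomial along progressions. -/
lemma parallelogram_zsmul_add (hp : ∀ P Q, h (P + Q) + h (P - Q) = 2 * h P + 2 * h Q) (P Q : G)
    (n : ℤ) : h (n • P + Q) = n ^ 2 * h P + n * (h (P + Q) - h P - h Q) + h Q := by
  have step : ∀ n : ℤ, h ((n + 1) • P + Q) + h ((n - 1) • P + Q) =
      2 * h (n • P + Q) + 2 * h P := fun n => by
    rw [← hp (n • P + Q) P]
    congr 2
    · rw [add_smul, one_smul]; abel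
    · rw [sub_smul, one_smul]; abel
  have both : h (n • P + Q) = n ^ 2 * h P + n * (h (P + Q) - h P - h Q) + h Q ∧
      h ((n + 1) • P + Q) =
        (n + 1) ^ 2 * h P + (n + 1) * (h (P + Q) - h P - h Q) + h Q := by
    induction n with
    | zero =>
      refine ⟨by simp, ?_⟩
      rw [zero_add, one_smul]
      ring
    | succ k ih =>
      refine ⟨ih.2, ?_⟩
      have := step (k + 1)
      rw [add_sub_cancel_right, ih.1, ih.2] at this
      linear_combination this
    | pred k ih =>
      have := step (-(k : ℤ))
      rw [ih.1, ih.2] at this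
      rw [sub_add_cancel]
      refine ⟨?_, ih.1⟩
      linear_combination this
  exact both.1

/-- The Cauchy–Schwarz inequality for the quadratic form `h`, at the pair `P`, `-Q`. -/
lemma parallelogram_sq_le (hp : ∀ P Q, h (P + Q) + h (P - Q) = 2 * h P + 2 * h Q)
    (h0 : ∀ P, 0 ≤ h P) (P Q : G) (hP : 0 < h P) :
    (h (P - Q) - h P - h Q) ^ 2 ≤ 4 * h P * h Q := by
  have hneg : h (P + Q) - h P - h Q = -(h (P - Q) - h P - h Q) := by linarith [hp P Q]
  set m := h (P + Q) - h P - h Q with hm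
  have key : ∀ a b : ℤ, h (a • P + b • Q) = a ^ 2 * h P + a * b * m + b ^ 2 * h Q := fun a b => by
    have hz : h 0 = 0 := by
      have := hp 0 0
      rw [add_zero, sub_zero] at this
      linarith
    have hb : h (b • Q) = b ^ 2 * h Q := by
      simpa [hz] using parallelogram_zsmul_add hp Q 0 b
    have hPb := parallelogram_zsmul_add hp Q P b
    rw [parallelogram_zsmul_add hp P (b • Q) a, add_comm P, hPb, hb, hm, add_comm P]
    ring
  -- Evaluate the binary quadratic form `h (a • P + b • Q)` at its minimum for fixed `b = 2 * h P`.
  have := h0 ((-m) • P + (2 * h P) • Q)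
  rw [key] at this
  have : 0 ≤ h P * (4 * h P * h Q - m ^ 2) := by linarith
  have := nonneg_of_mul_nonneg_right this hP
  rw [← neg_sq, ← hneg]
  linarith

end Parallelogram

/-! ### Points of the twist over a finite field -/

section FiniteField

open Polynomial WeierstrassCurve.Affine

variable {F : Type*} [Field F]

/-- The twistCubic `t(t + a)(t + b)`. -/
noncomputable def twistCubic (a b : F) : F[X] := X * (X + C a) * (X + C b)

lemma twistCubic_eq (a b : F) : twistCubic a b = X ^ 3 + C (a + b) * X ^ 2 + C (a * b) * X := by
  rw [twistCubic, C_add, C_mul]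
  ring

lemma twistCubic_monic (a b : F) : (twistCubic a b).Monic :=
  (monic_X.mul (monic_X_add_C a)).mul (monic_X_add_C b)

lemma natDegree_twistCubic (a b : F) : (twistCubic a b).natDegree = 3 := by
  rw [twistCubic_eq]
  compute_degree!

lemma eval_twistCubic (a b u : F) : (twistCubic a b).eval u = u * (u + a) * (u + b) := by
  simp [twistCubic]

variable [Fintype F]

lemma prod_univ_X_sub_C : ∏ u : F, (X - C u) = X ^ Fintype.card F - X := by
  have hq : 1 < Fintype.card F := Fintype.one_lt_card
  have hdeg := FiniteField.X_pow_card_sub_X_natDegree_eq F hq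
  have hmonic : (X ^ Fintype.card F - X : F[X]).Monic := monic_X_pow_sub (by simpa using hq)
  have := prod_multiset_X_sub_C_of_monic_of_roots_card_eq hmonic (by
    rw [FiniteField.roots_X_pow_card_sub_X, hdeg]
    rfl)
  rwa [FiniteField.roots_X_pow_card_sub_X] at this

lemma twistCubic_pow_card (a b : F) :
    twistCubic a b ^ Fintype.card F = X ^ (3 * Fintype.card F) +
      C (a + b) * X ^ (2 * Fintype.card F) + C (a * b) * X ^ Fintype.card F := by
  rw [← FiniteField.expand_card, twistCubic_eq]
  simp only [map_add, map_mul, expand_C, map_pow, expand_X]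
  ring

/-- The degree of the numerator, before cancellation, of the `x`-coordinate of the difference of the
identity and the Frobenius, written over the denominator `(t^q - t)²`. The terms of degree `3q` and
those of degree `2q` cancel. -/
lemma natDegree_difference_numerator (hF : ringChar F ≠ 2) (a b : F) :
    (twistCubic a b * ((twistCubic a b) ^ (Fintype.card F / 2) + 1) ^ 2 -
      (C (a + b) + X + X ^ Fintype.card F) * (X ^ Fintype.card F - X) ^ 2).natDegree =
      2 * Fintype.card F + 1 := by
  have hodd : 2 * (Fintype.card F / 2) + 1 = Fintype.card F := by
    have := FiniteField.odd_card_of_char_ne_two hF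
    omega
  have hq : 1 < Fintype.card F := Fintype.one_lt_card
  have hfrob := twistCubic_pow_card a b
  set q := Fintype.card F
  set m := q / 2
  have e : twistCubic a b * (twistCubic a b ^ m + 1) ^ 2 -
      (C (a + b) + X + X ^ q) * (X ^ q - X) ^ 2 = X ^ (2 * q + 1) +
        (X ^ (q + 2) + C (2 * (a + b)) * X ^ (q + 1) + C (a * b) * X ^ q - C (a + b) * X ^ 2 - X ^ 3
          + C 2 * twistCubic a b ^ (m + 1) + twistCubic a b) := by
    have : twistCubic a b * (twistCubic a b ^ m + 1) ^ 2 =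
        twistCubic a b ^ q + 2 * twistCubic a b ^ (m + 1) + twistCubic a b := by
      rw [← hodd]
      ring
    rw [this, hfrob]
    simp only [C_mul, C_add, map_ofNat]
    ring
  rw [e, natDegree_add_eq_left_of_natDegree_lt]
  · simp
  · have hc : (twistCubic a b ^ (m + 1)).natDegree = (m + 1) * 3 := by
      rw [natDegree_pow, natDegree_twistCubic]
    have hc' := natDegree_twistCubic a b
    rw [natDegree_X_pow, Nat.lt_succ_iff]
    have hX : ∀ k : ℕ, k ≤ 2 * q → (X ^ k : F[X]).natDegree ≤ 2 * q := fun k hk => by simpa using hk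
    have hCX : ∀ (c : F) (k : ℕ), k ≤ 2 * q → (C c * X ^ k : F[X]).natDegree ≤ 2 * q :=
      fun c k hk => (natDegree_C_mul_le _ _).trans (hX k hk)
    refine natDegree_add_le_of_degree_le (natDegree_add_le_of_degree_le
      ((natDegree_sub_le _ _).trans
        (max_le ((natDegree_sub_le _ _).trans (max_le (natDegree_add_le_of_degree_le
        (natDegree_add_le_of_degree_le (hX _ ?_) (hCX _ _ ?_)) (hCX _ _ ?_)) (hCX _ _ ?_)))
        (hX _ ?_))) ((natDegree_C_mul_le _ _).trans ?_)) ?_ <;> omega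

variable [DecidableEq F]

/-- The elements `u` of `F` at which `t(t + a)(t + b)` has quadratic character `s`. -/
def charFiber (a b : F) (s : ℤ) : Finset F :=
  {u : F | quadraticChar F (u * (u + a) * (u + b)) = s}

/-- The monic squarefree polynomial with set of roots `charFiber a b s`. -/
noncomputable def charFactor (a b : F) (s : ℤ) : F[X] := ∏ u ∈ charFiber a b s, (X - C u)

lemma monic_charFactor (a b : F) (s : ℤ) : (charFactor a b s).Monic :=
  monic_prod_X_sub_C _ _

lemma natDegree_charFactor (a b : F) (s : ℤ) :
    (charFactor a b s).natDegree = (charFiber a b s).card :=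
  natDegree_finsetProd_X_sub_C_eq_card _ _

lemma charFactor_zero {a b : F} (ha : a ≠ 0) (hb : b ≠ 0) (hab : a ≠ b) :
    charFactor a b 0 = twistCubic a b := by
  have h : charFiber a b 0 = {0, -a, -b} := by
    ext u
    simp only [charFiber, Finset.mem_filter, Finset.mem_univ, true_and, quadraticChar_eq_zero_iff,
      mul_eq_zero, Finset.mem_insert, Finset.mem_singleton, add_eq_zero_iff_eq_neg, or_assoc]
  rw [charFactor, h, Finset.prod_insert (by simp [ha, hb]),
    Finset.prod_insert (by simpa using hab), Finset.prod_singleton, twistCubic]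
  simp [mul_assoc]

lemma prod_univ_eq_charFiber {M : Type*} [CommMonoid M] (a b : F) (f : F → M) :
    ∏ u, f u = (∏ u ∈ charFiber a b 0, f u) * (∏ u ∈ charFiber a b 1, f u) *
      ∏ u ∈ charFiber a b (-1), f u := by
  rw [← Finset.prod_union, ← Finset.prod_union]
  · congr 1
    ext u
    simp only [charFiber, Finset.mem_union, Finset.mem_filter, Finset.mem_univ, true_and, true_iff]
    by_cases h : u * (u + a) * (u + b) = 0
    · simp [h]
    · rcases quadraticChar_dichotomy h with h | h <;> simp [h]
  · rw [Finset.disjoint_left]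
    simp only [charFiber, Finset.mem_union, Finset.mem_filter, Finset.mem_univ, true_and]
    omega
  · rw [Finset.disjoint_left]
    simp only [charFiber, Finset.mem_filter, Finset.mem_univ, true_and]
    omega

lemma charFactor_mul (a b : F) :
    charFactor a b 0 * charFactor a b 1 * charFactor a b (-1) = X ^ Fintype.card F - X := by
  rw [← prod_univ_X_sub_C, prod_univ_eq_charFiber a b]
  rfl

lemma card_charFiber_add (a b : F) :
    (charFiber a b 0).card + (charFiber a b 1).card + (charFiber a b (-1)).card =
      Fintype.card F := by
  have h := congrArg natDegree (charFactor_mul a b)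
  rw [FiniteField.X_pow_card_sub_X_natDegree_eq F Fintype.one_lt_card,
    ((monic_charFactor a b 0).mul (monic_charFactor a b 1)).natDegree_mul (monic_charFactor a b _),
    (monic_charFactor a b 0).natDegree_mul (monic_charFactor a b 1)] at h
  simpa only [natDegree_charFactor] using h

lemma card_charFiber_zero {a b : F} (ha : a ≠ 0) (hb : b ≠ 0) (hab : a ≠ b) :
    (charFiber a b 0).card = 3 := by
  rw [← natDegree_charFactor, charFactor_zero ha hb hab, natDegree_twistCubic]

lemma sum_quadraticChar_eq (a b : F) :
    ∑ u, quadraticChar F (u * (u + a) * (u + b)) =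
      (charFiber a b 1).card - (charFiber a b (-1)).card := by
  have hs : ∀ s : ℤ, ∑ u ∈ charFiber a b s, quadraticChar F (u * (u + a) * (u + b)) =
      (charFiber a b s).card * s := fun s => by
    have hconst : ∀ u ∈ charFiber a b s, quadraticChar F (u * (u + a) * (u + b)) = s :=
      fun u hu => (Finset.mem_filter.1 hu).2
    rw [Finset.sum_congr rfl hconst, Finset.sum_const, nsmul_eq_mul]
  have := prod_univ_eq_charFiber (M := Multiplicative ℤ) a b
    fun u => Multiplicative.ofAdd (quadraticChar F (u * (u + a) * (u + b)))
  have h : ∑ u, quadraticChar F (u * (u + a) * (u + b)) = _ := this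
  rw [h]
  change (∑ u ∈ charFiber a b 0, quadraticChar F (u * (u + a) * (u + b))) +
    (∑ u ∈ charFiber a b 1, quadraticChar F (u * (u + a) * (u + b))) +
    (∑ u ∈ charFiber a b (-1), quadraticChar F (u * (u + a) * (u + b))) = _
  rw [hs, hs, hs]
  ring

lemma eval_twistCubic_pow (hF : ringChar F ≠ 2) {a b u : F} {s : ℤ} (hu : u ∈ charFiber a b s) :
    ((twistCubic a b) ^ (Fintype.card F / 2) + 1).eval u = (s : F) + 1 := by
  have := (Finset.mem_filter.1 hu).2
  rw [eval_add, eval_pow, eval_twistCubic, ← quadraticChar_eq_pow_of_char_ne_two' hF, this,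
    eval_one]

/-- By Euler's criterion, `f ^ ((q-1)/2) + 1` vanishes exactly where `f` is a nonsquare; this
extracts its factor with these roots, leaving a cofactor prime to the other linear factors. -/
lemma exists_twistCubic_pow_add_one_eq (hF : ringChar F ≠ 2) (a b : F) :
    ∃ s : F[X], (twistCubic a b) ^ (Fintype.card F / 2) + 1 = charFactor a b (-1) * s ∧
      IsCoprime s (charFactor a b 0) ∧ IsCoprime s (charFactor a b 1) := by
  have h2 : (2 : F) ≠ 0 := Ring.two_ne_zero hF
  have hdvd : charFactor a b (-1) ∣ (twistCubic a b) ^ (Fintype.card F / 2) + 1 := by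
    refine Finset.prod_dvd_of_coprime
      (fun u _ v _ huv => isCoprime_X_sub_C_of_isUnit_sub (sub_ne_zero.2 huv).isUnit) fun u hu => ?_
    rw [dvd_iff_isRoot, IsRoot.def, eval_twistCubic_pow hF hu]
    simp
  obtain ⟨s, hs⟩ := hdvd
  have cop : ∀ k : ℤ, (k : F) + 1 ≠ 0 → IsCoprime s (charFactor a b k) := fun k hk => by
    refine IsCoprime.prod_right fun u hu => IsCoprime.symm ?_
    refine (Irreducible.coprime_iff_not_dvd (irreducible_X_sub_C u)).2 fun hd => hk ?_
    rw [← eval_twistCubic_pow hF hu, hs, eval_mul, dvd_iff_isRoot.1 hd, mul_zero]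
  refine ⟨s, hs, cop 0 (by simp), cop 1 ?_⟩
  rw [Int.cast_one, one_add_one_eq_two]
  exact h2

/-- Endomorphisms of the constant curve give points of the twist: that of the identity has
height `1`, that of the Frobenius has height `q`, and the difference has height equal to the number
of fixed points of the Frobenius on `y² = u(u + a)(u + b)`. -/
lemma exists_points_twistedHeight [DecidableEq (RatFunc F)] (hF : ringChar F ≠ 2) {a b : F}
    (ha : a ≠ 0) (hb : b ≠ 0) (hab : a ≠ b) :
    ∃ P Q : (twistedCurve (a + b) (a * b) (algebraMap F[X] (RatFunc F) (twistCubic a b))).Point,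
      twistedHeight P = 1 ∧ twistedHeight Q = Fintype.card F ∧
        twistedHeight (P - Q) = 2 * (charFiber a b 1).card + 4 := by
  have hodd : 2 * (Fintype.card F / 2) + 1 = Fintype.card F := by
    have := FiniteField.odd_card_of_char_ne_two hF
    omega
  have hfrob := twistCubic_pow_card a b
  obtain ⟨s, hs, hs0, hs1⟩ := exists_twistCubic_pow_add_one_eq hF a b
  have hdeg := natDegree_difference_numerator hF a b
  have hcard := card_charFiber_add a b
  have hcard0 := card_charFiber_zero ha hb hab
  have hfactor := charFactor_mul a b
  have hL0 := charFactor_zero ha hb hab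
  have h2 : (2 : RatFunc F) ≠ 0 := by
    have := (map_ne_zero_iff _ (algebraMap F (RatFunc F)).injective).2 (Ring.two_ne_zero hF)
    rwa [map_ofNat] at this
  have hcub := twistCubic_eq a b
  have hmonic := twistCubic_monic a b
  set q := Fintype.card F
  set m := q / 2
  set f := twistCubic a b
  set φ := algebraMap F[X] (RatFunc F) with hφ
  have hδ : φ f ≠ 0 := RatFunc.algebraMap_ne_zero hmonic.ne_zero
  have hfK : φ f = φ X ^ 3 + φ (C (a + b)) * φ X ^ 2 + φ (C (a * b)) * φ X := by
    rw [hcub]; simp only [map_add, map_mul, map_pow]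
  have hfrobK : φ f ^ q =
      φ X ^ (3 * q) + φ (C (a + b)) * φ X ^ (2 * q) + φ (C (a * b)) * φ X ^ q := by
    rw [← map_pow, hfrob]; simp only [map_add, map_mul, map_pow]
  -- The identity endomorphism gives the point with `x / δ = t`, the Frobenius that with `t ^ q`.
  have hP : (twistedCurve (a + b) (a * b) (φ f)).Nonsingular (φ f * (φ X / φ 1)) (φ f ^ 2) := by
    refine twoTorsionCurve_nonsingular h2 ?_ (pow_ne_zero 2 hδ)
    rw [map_one, div_one]
    linear_combination φ f ^ 3 * hfK
  have hQ : (twistedCurve (a + b) (a * b) (φ f)).Nonsingular (φ f * (φ (X ^ q) / φ 1))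
      (φ f ^ 2 * φ f ^ m) := by
    refine twoTorsionCurve_nonsingular h2 ?_ (mul_ne_zero (pow_ne_zero 2 hδ) (pow_ne_zero m hδ))
    have : (φ f ^ 2 * φ f ^ m) ^ 2 = φ f ^ 3 * φ f ^ q := by
      rw [← hodd]; ring
    rw [map_one, div_one, map_pow, this, hfrobK]
    ring
  have hX : (φ f * (φ X / φ 1)) ≠ (φ f * (φ (X ^ q) / φ 1)) := by
    rw [map_one, div_one, div_one]
    intro h
    have h' := RatFunc.algebraMap_injective F (mul_left_cancel₀ hδ h)
    exact FiniteField.X_pow_card_sub_X_ne_zero F Fintype.one_lt_card (sub_eq_zero.2 h'.symm)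
  refine ⟨.some _ _ hP, .some _ _ hQ, ?_, ?_, ?_⟩
  · rw [(isReducedCoord_some hδ one_ne_zero isCoprime_one_right hP rfl).twistedHeight_eq hδ]
    simp [pairDegree]
  · rw [(isReducedCoord_some hδ one_ne_zero isCoprime_one_right hQ rfl).twistedHeight_eq hδ]
    simp [pairDegree]
  · set L1 := charFactor a b 1
    set L := charFactor a b (-1)
    have mL1 : L1.Monic := monic_charFactor a b 1
    have mL : L.Monic := monic_charFactor a b (-1)
    rw [hL0] at hfactor hs0
    -- After cancelling the common factor `f * L ^ 2`, the rational function `x / δ` has the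
    -- following coprime numerator and denominator.
    have hden : (f * L1 ^ 2).Monic := hmonic.mul (mL1.pow 2)
    have hcop : IsCoprime (s ^ 2 - (C (a + b) + X + X ^ q) * (f * L1 ^ 2)) (f * L1 ^ 2) := by
      rw [sub_eq_add_neg, ← neg_mul, IsCoprime.add_mul_right_left_iff]
      exact (IsCoprime.mul_right hs0 hs1.pow_right).pow_left
    have hnum : (s ^ 2 - (C (a + b) + X + X ^ q) * (f * L1 ^ 2)) * (f * L ^ 2) =
        f * (f ^ m + 1) ^ 2 - (C (a + b) + X + X ^ q) * (X ^ q - X) ^ 2 := by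
      rw [hs, ← hfactor]
      ring
    have dL1 : L1.natDegree = (charFiber a b 1).card := natDegree_charFactor a b 1
    have dL : L.natDegree = (charFiber a b (-1)).card := natDegree_charFactor a b (-1)
    have df : f.natDegree = 3 := natDegree_twistCubic a b
    have hne : s ^ 2 - (C (a + b) + X + X ^ q) * (f * L1 ^ 2) ≠ 0 := by
      intro h0
      rw [← hnum, h0, zero_mul, natDegree_zero] at hdeg
      omega
    rw [← hnum, natDegree_mul hne (hmonic.mul (mL.pow 2)).ne_zero, hmonic.natDegree_mul (mL.pow 2),
      natDegree_pow, dL, df] at hdeg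
    have ddden : (f * L1 ^ 2).natDegree = 3 + 2 * (charFiber a b 1).card := by
      rw [hmonic.natDegree_mul (mL1.pow 2), natDegree_pow, dL1, df]
    rw [sub_eq_add_neg, Point.neg_some, Point.add_of_X_ne hX,
      (isReducedCoord_some hδ hden.ne_zero hcop _ _).twistedHeight_eq hδ, pairDegree, ddden]
    · omega
    · simp only [addX, slope_of_X_ne hX, negY, twoTorsionCurve]
      have hL0' : φ L ≠ 0 := RatFunc.algebraMap_ne_zero mL.ne_zero
      have hL1' : φ L1 ≠ 0 := RatFunc.algebraMap_ne_zero mL1.ne_zero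
      have hsK : φ f ^ m + 1 = φ L * φ s := by
        rw [← map_pow, ← map_one φ, ← map_add, hs, map_mul]
      have hfK' : φ X ^ q - φ X = φ f * φ L1 * φ L := by
        rw [← map_pow, ← map_sub, ← hfactor, map_mul, map_mul]
      -- The slope of the line through `P` and `-Q`.
      have hslope : (φ f ^ 2 - (-(φ f ^ 2 * φ f ^ m) - 0 * (φ f * (φ (X ^ q) / φ 1)) - 0)) /
          (φ f * (φ X / φ 1) - φ f * (φ (X ^ q) / φ 1)) = -φ s / φ L1 := by
        rw [map_one, div_one, div_one, map_pow]
        have e1 : φ f ^ 2 - (-(φ f ^ 2 * φ f ^ m) - 0 * (φ f * φ X ^ q) - 0) =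
            φ f ^ 2 * (φ L * φ s) := by rw [← hsK]; ring
        have e2 : φ f * φ X - φ f * φ X ^ q = -(φ f * (φ f * φ L1 * φ L)) := by rw [← hfK']; ring
        rw [e1, e2]
        field_simp
      rw [hslope]
      simp only [← hφ, map_one, div_one, map_sub, map_mul, map_pow, map_add]
      field_simp
      ring

/-- The Hasse bound for `y² = u(u + a)(u + b)`. -/
lemma sq_sum_quadraticChar_le (hF : ringChar F ≠ 2) {a b : F} (ha : a ≠ 0) (hb : b ≠ 0)
    (hab : a ≠ b) :
    (∑ u, quadraticChar F (u * (u + a) * (u + b))) ^ 2 ≤ 4 * (Fintype.card F : ℤ) := by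
  classical
  obtain ⟨P, Q, hP, hQ, hPQ⟩ := exists_points_twistedHeight hF ha hb hab
  have hδ : algebraMap F[X] (RatFunc F) (twistCubic a b) ≠ 0 :=
    RatFunc.algebraMap_ne_zero (twistCubic_monic a b).ne_zero
  have hAB : (a + b) ^ 2 - 4 * (a * b) ≠ 0 := by
    have : (a + b) ^ 2 - 4 * (a * b) = (a - b) ^ 2 := by ring
    rw [this]
    exact pow_ne_zero 2 (sub_ne_zero.2 hab)
  have := parallelogram_sq_le (h := fun P => (twistedHeight P : ℤ))
    (fun P Q => by
      exact_mod_cast twistedHeight_add_add_twistedHeight_sub (Ring.two_ne_zero hF)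
        (mul_ne_zero ha hb) hAB hδ P Q)
    (fun P => Int.natCast_nonneg _) P Q (by simp [hP])
  simp only [hP, hQ, hPQ] at this
  have hcard := card_charFiber_add a b
  rw [card_charFiber_zero ha hb hab] at hcard
  rw [sum_quadraticChar_eq]
  have e : ((2 * (charFiber a b 1).card + 4 : ℕ) : ℤ) - (1 : ℕ) - (Fintype.card F : ℤ) =
      (charFiber a b 1).card - (charFiber a b (-1)).card := by
    rw [← hcard]
    push_cast
    ring
  rwa [e, Nat.cast_one, mul_one] at this

end FiniteField

/-! ### Counting points -/

section Counting

variable {F : Type*} [Field F] [Fintype F] [DecidableEq F]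

lemma sum_comp_sq (hF : ringChar F ≠ 2) (g : F → ℤ) :
    ∑ x, g (x ^ 2) = ∑ u, (quadraticChar F u + 1) * g u := by
  rw [← Finset.sum_fiberwise' Finset.univ (fun x : F => x ^ 2) g]
  refine Finset.sum_congr rfl fun u _ => ?_
  rw [Finset.sum_const, nsmul_eq_mul, ← quadraticChar_card_sqrts hF u]
  congr 3
  ext x
  simp

lemma sum_quadraticChar_add (hF : ringChar F ≠ 2) (c : F) : ∑ u, quadraticChar F (u + c) = 0 := by
  rw [← quadraticChar_sum_zero hF]
  exact Fintype.sum_equiv (Equiv.addRight c) _ _ fun _ => rfl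

lemma sum_quadraticChar_mul_add (hF : ringChar F ≠ 2) {c : F} (hc : c ≠ 0) :
    ∑ u, quadraticChar F (u * (u + c)) = -1 := by
  have hJ := jacobiSum_nontrivial_inv (quadraticChar_ne_one hF)
  rw [(quadraticChar_isQuadratic F).inv, jacobiSum] at hJ
  -- The substitution `u = -cx` turns the sum into a Jacobi sum.
  have h : ∑ u, quadraticChar F (u * (u + c)) =
      ∑ x, quadraticChar F (-1) * (quadraticChar F x * quadraticChar F (1 - x)) := by
    refine (Fintype.sum_equiv (Equiv.mulLeft₀ (-c) (neg_ne_zero.2 hc)) _ _ fun x => ?_).symm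
    have e : -c * x * (-c * x + c) = c ^ 2 * (-1 * (x * (1 - x))) := by ring
    change _ = quadraticChar F (-c * x * (-c * x + c))
    rw [e, map_mul, quadraticChar_sq_one' hc, one_mul, map_mul, map_mul]
  rw [h, ← Finset.mul_sum, hJ, mul_neg, ← sq, quadraticChar_sq_one (neg_ne_zero.2 one_ne_zero)]

lemma sum_quadraticChar_sq_add (hF : ringChar F ≠ 2) {c : F} (hc : c ≠ 0) :
    ∑ x, quadraticChar F (x ^ 2 + c) = -1 := by
  rw [sum_comp_sq hF fun u => quadraticChar F (u + c)]
  simp only [add_mul, one_mul, ← map_mul, Finset.sum_add_distrib]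
  rw [sum_quadraticChar_mul_add hF hc, sum_quadraticChar_add hF, add_zero]

lemma sum_quadraticChar_sq_add_mul (hF : ringChar F ≠ 2) {a b : F} (hab : a ≠ b) :
    ∑ x, quadraticChar F (x ^ 2 + a) * quadraticChar F (x ^ 2 + b) =
      ∑ u, quadraticChar F (u * (u + a) * (u + b)) - 1 := by
  rw [sum_comp_sq hF fun u => quadraticChar F (u + a) * quadraticChar F (u + b)]
  have hmul : ∀ u : F, (quadraticChar F u + 1) * (quadraticChar F (u + a) * quadraticChar F (u + b))
      = quadraticChar F (u * (u + a) * (u + b)) + quadraticChar F ((u + a) * (u + b)) := fun u => by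
    simp only [map_mul]
    ring
  have h : ∑ u, quadraticChar F ((u + a) * (u + b)) = -1 := by
    rw [← sum_quadraticChar_mul_add hF (sub_ne_zero.2 hab.symm)]
    refine Fintype.sum_equiv (Equiv.addRight a) _ _ fun u => ?_
    rw [Equiv.coe_addRight]
    congr 2
    ring
  simp only [hmul, Finset.sum_add_distrib]
  rw [h]
  ring

lemma card_intersection_eq (hF : ringChar F ≠ 2) {a b : F} (ha : a ≠ 0) (hb : b ≠ 0)
    (hab : a ≠ b) :
    (Nat.card {t : F × F × F // t.1 ^ 2 + a = t.2.1 ^ 2 ∧ t.1 ^ 2 + b = t.2.2 ^ 2} : ℤ) =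
      Fintype.card F - 3 + ∑ u, quadraticChar F (u * (u + a) * (u + b)) := by
  have hsq : ∀ c : F, ∑ y : F, (if c = y ^ 2 then (1 : ℤ) else 0) = quadraticChar F c + 1 :=
    fun c => by
      rw [← quadraticChar_card_sqrts hF c, Finset.sum_boole]
      congr 2
      ext y
      simp [eq_comm]
  have hcard : (Nat.card {t : F × F × F // t.1 ^ 2 + a = t.2.1 ^ 2 ∧ t.1 ^ 2 + b = t.2.2 ^ 2} : ℤ) =
      ∑ x, (quadraticChar F (x ^ 2 + a) + 1) * (quadraticChar F (x ^ 2 + b) + 1) := by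
    rw [Nat.card_eq_fintype_card, Fintype.card_subtype, ← Finset.sum_boole, Fintype.sum_prod_type]
    refine Finset.sum_congr rfl fun x _ => ?_
    rw [Fintype.sum_prod_type, ← hsq, ← hsq, Finset.sum_mul_sum]
    refine Finset.sum_congr rfl fun y _ => Finset.sum_congr rfl fun z _ => ?_
    rw [ite_and, ite_mul, one_mul, zero_mul]
  have hexp : ∀ x : F, (quadraticChar F (x ^ 2 + a) + 1) * (quadraticChar F (x ^ 2 + b) + 1) =
      quadraticChar F (x ^ 2 + a) * quadraticChar F (x ^ 2 + b) + quadraticChar F (x ^ 2 + a) +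
        quadraticChar F (x ^ 2 + b) + 1 := fun x => by ring
  simp only [hcard, hexp, Finset.sum_add_distrib]
  rw [sum_quadraticChar_sq_add_mul hF hab, sum_quadraticChar_sq_add hF ha,
    sum_quadraticChar_sq_add hF hb, Finset.sum_const, Finset.card_univ, nsmul_eq_mul]
  ring

lemma ZMod.two_eq_of_ne_zero : ∀ a b : ZMod 2, a ≠ 0 → b ≠ 0 → a = b := by decide

end Counting

theorem mainTheorem7 (p : ℕ) [Fact p.Prime] (a b : ZMod p) (ha : a ≠ 0) (hb : b ≠ 0)
    (hab : a ≠ b) :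
    |(Nat.card {t : ZMod p × ZMod p × ZMod p //
        t.1 ^ 2 + a = t.2.1 ^ 2 ∧ t.1 ^ 2 + b = t.2.2 ^ 2} : ℝ) - ((p : ℝ) - 3)|
      ≤ 2 * Real.sqrt p := by
  -- In characteristic `2` there are no two distinct nonzero elements.
  have hF : ringChar (ZMod p) ≠ 2 := by
    rw [ZMod.ringChar_zmod_n]
    rintro rfl
    exact hab (ZMod.two_eq_of_ne_zero a b ha hb)
  have hcard := card_intersection_eq hF ha hb hab
  have hle := sq_sum_quadraticChar_le hF ha hb hab
  rw [ZMod.card] at hcard hle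
  set T := ∑ u, quadraticChar (ZMod p) (u * (u + a) * (u + b))
  have hN : (Nat.card {t : ZMod p × ZMod p × ZMod p //
      t.1 ^ 2 + a = t.2.1 ^ 2 ∧ t.1 ^ 2 + b = t.2.2 ^ 2} : ℝ) - ((p : ℝ) - 3) = (T : ℝ) := by
    have : (Nat.card {t : ZMod p × ZMod p × ZMod p //
      t.1 ^ 2 + a = t.2.1 ^ 2 ∧ t.1 ^ 2 + b = t.2.2 ^ 2} : ℝ) = p - 3 + T := by
      exact_mod_cast hcard
    rw [this]
    ring
  have hle' : (T : ℝ) ^ 2 ≤ 4 * p := by exact_mod_cast hle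
  rw [hN]
  apply abs_le_of_sq_le_sq _ (by positivity)
  rw [mul_pow, Real.sq_sqrt (Nat.cast_nonneg p)]
  linarith
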